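/- Let $\Gamma\subset\mathrm{PSL}_2(\mathbb{R})$ be a Fuchsian group of the first kind (a discrete subgroup such that $\Gamma\backslash\mathbb{H}$ has finite hyperbolic area), acting on the upper half-plane $\mathbb{H}$. Let $p\in\mathbb{R}\cup\{\infty\}$ be a cusp of $\Gamma$ with scaling matrix $\sigma\in\mathrm{PSL}_2(\mathbb{R})$, i.e. the stabilizer $\Gamma_p=\mathrm{Stab}_\Gamma(p)=\langle\gamma\rangle$ is generated by a primitive parabolic $\gamma\in\Gamma$ with $\sigma^{-1}\gamma\sigma=\begin{pmatrix}1&1\\0&1\end{pmatrix}$. For $z,w\in\mathbb{H}$ with $z\notin\Gamma w$ and $s\in\mathbb{C}$ with $\mathrm{Re}(s)>1$ put $$\mathcal{E}^{\mathrm{par}}_{p}(z,s)=\sum_{\eta\in\Gamma_p\backslash\Gamma}\mathrm{Im}(\sigma^{-1}\eta z)^s,\qquad G_s(z,w)=\frac1{2\pi}\sum_{\eta\in\Gamma}Q_{s-1}\bigl(1+2u(z,\eta w)\bigr),\qquad u(z,w)=\frac{|z-w|^2}{4\,\mathrm{Im}(z)\,\mathrm{Im}(w)},$$ where $Q_\nu$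 is the Legendre function of the second kind. For $x>1$ and $\mathrm{Re}(\nu)>-1$ it is given by $Q_\nu(x)=2^{-\nu-1}\int_{-1}^1(1-t^2)^\nu(x-t)^{-\nu-1}\,dt$. Let $z\in\mathbb{H}$, $s\in\mathbb{C}$ with $\mathrm{Re}(s)>1$, and let $a>0$ satisfy $a>\mathrm{Im}(\sigma^{-1}\eta z)$ for all $\eta\in\Gamma$. Let $L_a=\{w\in\mathbb{H}: \mathrm{Re}(w)\in[0,1],\ \mathrm{Im}(w)=a\}$ and $L_p=\sigma L_a$. Then the series for $\mathcal{E}^{\mathrm{par}}_{p}(z,s)$ converges absolutely; no point $w\in L_p$ is $\Gamma$-equivalent to $z$, and for each such $w$ the series for $G_s(z,w)$ converges absolutely; the function $w\mapsto G_s(z,w)$ is integrable along $L_p$; and $$\mathcal{E}^{\mathrm{par}}_{p}(z,s)=(2s-1)\,a^{s}\int_{L_p}G_s(z,w)\,ds_{\mathrm{hyp}}(w)=(2s-1)\,a^{s-1}\int_0^1G_s\bigl(z,\sigma(x+ia)\bigr)\,dx,$$ where $ds_{\mathrm{hyp}}(w)=|dw|/\mathrm{Im}(w)$ is the hyperbolic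 arc length. -/

import Mathlib

open MeasureTheory
open scoped UpperHalfPlane MatrixGroups Pointwise

noncomputable section

/-- `PSL(2, ℝ)` acts on the upper half-plane by fractional linear transformations. -/
instance pslUpperHalfPlaneAction : MulAction PSL(2, ℝ) ℍ :=
  MulAction.compHom ℍ
    (Matrix.ProjectiveSpecialLinearGroup.toPGL : PSL(2, ℝ) →* PGL(2, ℝ))

theorem glScalar_smul_onePoint (u : ℝˣ) (c : OnePoint ℝ) :
    Matrix.GeneralLinearGroup.scalar (Fin 2) u • c = c := by
  cases c with
  | infty => simp [OnePoint.smul_infty_eq_ite]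
  | coe c => simp [OnePoint.smul_some_eq_ite]

/-- `PSL(2, ℝ)` acts on the boundary `ℝ ∪ {∞}` of the upper half-plane by fractional linear
transformations. -/
instance pslBoundaryAction : MulAction PSL(2, ℝ) (OnePoint ℝ) :=
  letI : MulAction PGL(2, ℝ) (OnePoint ℝ) :=
    Matrix.ProjGenLinGroup.mulActionOfGL glScalar_smul_onePoint
  MulAction.compHom (OnePoint ℝ)
    (Matrix.ProjectiveSpecialLinearGroup.toPGL : PSL(2, ℝ) →* PGL(2, ℝ))

theorem psl_mk_smul (g : SL(2, ℝ)) (z : ℍ) : ((g : PSL(2, ℝ)) • z : ℍ) = g • z := rfl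

theorem psl_mk_smul_onePoint (g : SL(2, ℝ)) (c : OnePoint ℝ) :
    ((g : PSL(2, ℝ)) • c : OnePoint ℝ) = Matrix.SpecialLinearGroup.toGL g • c := rfl

/-- A Fuchsian group of the first kind: a discrete subgroup of `PSL(2, ℝ)` whose quotient of the
upper half-plane has finite hyperbolic area (`volume` on `ℍ` is `dx dy / y ^ 2`). -/
structure IsFuchsianFirstKind (Γ : Subgroup PSL(2, ℝ)) : Prop where
  discrete : DiscreteTopology Γ
  finite_area : ∃ F : Set ℍ, IsFundamentalDomain Γ F volume ∧ volume F < ⊤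

/-- The matrix `(1 1; 0 1)` in `SL(2, ℝ)`. -/
def unitTranslationSL : SL(2, ℝ) := ⟨!![1, 1; 0, 1], by simp⟩

/-- The class of `(1 1; 0 1)` in `PSL(2, ℝ)`, which acts as `z ↦ z + 1`. -/
def unitTranslation : PSL(2, ℝ) := QuotientGroup.mk unitTranslationSL

theorem coe_unitTranslation_smul (z : ℍ) : ((unitTranslation • z : ℍ) : ℂ) = z + 1 := by
  rw [unitTranslation, psl_mk_smul, UpperHalfPlane.coe_specialLinearGroup_apply]
  simp [unitTranslationSL]

/-- `p` is a cusp of `Γ` with scaling matrix `σ`: the stabilizer `Γ_p` is generated by an element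
`γ` with `σ⁻¹ γ σ = (1 1; 0 1)`. In particular `γ` is a primitive parabolic element of `Γ` and `p`
is its fixed point. -/
def IsScalingMatrix (Γ : Subgroup PSL(2, ℝ)) (p : OnePoint ℝ) (σ : PSL(2, ℝ)) : Prop :=
  ∃ γ : Γ, MulAction.stabilizer Γ p = Subgroup.zpowers γ ∧
    σ⁻¹ * (γ : PSL(2, ℝ)) * σ = unitTranslation

/-- The right cosets `Γ_p \ Γ`. -/
abbrev CuspCosets (Γ : Subgroup PSL(2, ℝ)) (p : OnePoint ℝ) : Type :=
  Quotient (QuotientGroup.rightRel (MulAction.stabilizer Γ p))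

/-- The term `Im(σ⁻¹ η z) ^ s` of the parabolic Eisenstein series, for the coset `q = Γ_p η`. When
`σ` is a scaling matrix for the cusp `p`, it does not depend on the representative `η` of `q`. -/
def parEisensteinTerm (Γ : Subgroup PSL(2, ℝ)) (p : OnePoint ℝ) (σ : PSL(2, ℝ)) (z : ℍ) (s : ℂ)
    (q : CuspCosets Γ p) : ℂ :=
  (((σ⁻¹ • (q.out : PSL(2, ℝ)) • z : ℍ).im : ℝ) : ℂ) ^ s

theorem im_unitTranslation_zpow_smul (n : ℤ) (z : ℍ) : (unitTranslation ^ n • z : ℍ).im = z.im := by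
  have h (w : ℍ) : (unitTranslation • w : ℍ).im = w.im := by
    have := congrArg Complex.im (coe_unitTranslation_smul w)
    simpa using this
  induction n with
  | zero => simp
  | succ n ih => rw [zpow_add_one, ← (Commute.zpow_self unitTranslation _).eq.symm, mul_smul, h, ih]
  | pred n ih => rw [← ih, ← h, ← mul_smul, ← zpow_one_add]; simp

/-- The parabolic Eisenstein series
`E_p(z, s) = ∑ Im(σ⁻¹ η z) ^ s`, summed over `η ∈ Γ_p \ Γ`. -/
def parEisenstein (Γ : Subgroup PSL(2, ℝ)) (p : OnePoint ℝ) (σ : PSL(2, ℝ)) (z : ℍ) (s : ℂ) : ℂ :=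
  ∑' q : CuspCosets Γ p, parEisensteinTerm Γ p σ z s q

/-- The term of the parabolic Eisenstein series does not depend on the representative. -/
theorem parEisensteinTerm_mk {Γ : Subgroup PSL(2, ℝ)} {p : OnePoint ℝ} {σ : PSL(2, ℝ)}
    (hσ : IsScalingMatrix Γ p σ) (z : ℍ) (s : ℂ) (η : Γ) :
    parEisensteinTerm Γ p σ z s (Quotient.mk _ η) =
      (((σ⁻¹ • (η : PSL(2, ℝ)) • z : ℍ).im : ℝ) : ℂ) ^ s := by
  obtain ⟨γ, hγ, hγσ⟩ := hσ
  have h1 : η * ((Quotient.mk (QuotientGroup.rightRel (MulAction.stabilizer Γ p)) η).out)⁻¹ ∈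
      MulAction.stabilizer Γ p :=
    QuotientGroup.rightRel_apply.1 (Quotient.exact (Quotient.out_eq _))
  unfold parEisensteinTerm
  generalize (Quotient.mk (QuotientGroup.rightRel (MulAction.stabilizer Γ p)) η).out = ζ at h1 ⊢
  rw [hγ, Subgroup.mem_zpowers_iff] at h1
  obtain ⟨n, hn⟩ := h1
  have h2 : (η : PSL(2, ℝ)) = (γ : PSL(2, ℝ)) ^ n * ζ := by
    have : η = γ ^ n * ζ := by rw [hn]; group
    rw [this]; simp
  have h3 : (γ : PSL(2, ℝ)) = σ * unitTranslation * σ⁻¹ := by rw [← hγσ]; group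
  have h4 : σ⁻¹ • (η : PSL(2, ℝ)) • z = unitTranslation ^ n • σ⁻¹ • (ζ : PSL(2, ℝ)) • z := by
    rw [h2, h3, conj_zpow]; simp [← mul_smul, mul_assoc]
  rw [h4, im_unitTranslation_zpow_smul]

/-- The Legendre function of the second kind,
`Q_ν(x) = 2 ^ (-ν - 1) ∫_{-1}^{1} (1 - t²) ^ ν (x - t) ^ (-ν - 1) dt`, for `Re ν > -1`, `x > 1`. -/
def legendreQ (ν : ℂ) (x : ℝ) : ℂ :=
  (2 : ℂ) ^ (-ν - 1) *
    ∫ t in (-1 : ℝ)..1, ((1 - t ^ 2 : ℝ) : ℂ) ^ ν * ((x - t : ℝ) : ℂ) ^ (-ν - 1)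

/-- The point-pair invariant `u(z, w) = |z - w|² / (4 Im z Im w)`. -/
def pointPairU (z w : ℍ) : ℝ :=
  ‖(z : ℂ) - (w : ℂ)‖ ^ 2 / (4 * z.im * w.im)

/-- The term of the series of the hyperbolic Green's function. -/
def greenTerm (Γ : Subgroup PSL(2, ℝ)) (s : ℂ) (z w : ℍ) (η : Γ) : ℂ :=
  legendreQ (s - 1) (1 + 2 * pointPairU z ((η : PSL(2, ℝ)) • w))

/-- The hyperbolic Green's function of `Γ \ ℍ`,
`G_s(z, w) = (1 / 2π) ∑_{η ∈ Γ} Q_{s-1}(1 + 2 u(z, η w))`. -/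
def hypGreen (Γ : Subgroup PSL(2, ℝ)) (s : ℂ) (z w : ℍ) : ℂ :=
  1 / (2 * (Real.pi : ℂ)) * ∑' η : Γ, greenTerm Γ s z w η

/-- The density of the arc length `ds_hyp = |dw| / Im w` along a curve in the upper half-plane. -/
def hypSpeed (c : ℝ → ℍ) (t : ℝ) : ℝ :=
  ‖deriv (fun τ : ℝ => (c τ : ℂ)) t‖ / (c t).im

/-- The integral of `f` with respect to hyperbolic arc length along the curve `c : [t₀, t₁] → ℍ`. -/
def hypArcIntegral (f : ℍ → ℂ) (c : ℝ → ℍ) (t₀ t₁ : ℝ) : ℂ :=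
  ∫ t in t₀..t₁, f (c t) * (hypSpeed c t : ℂ)

/-- The horocycle segment `L_a = {w : Re w ∈ [0, 1], Im w = a}`. -/
def horocycle (a : ℝ) : Set ℍ := {w | w.re ∈ Set.Icc (0 : ℝ) 1 ∧ w.im = a}

/-- The curve `x ↦ σ (x + i a)`, which for `x ∈ [0, 1]` parametrizes `σ L_a`. -/
def horocyclePath (σ : PSL(2, ℝ)) {a : ℝ} (ha : 0 < a) (x : ℝ) : ℍ :=
  σ • (⟨⟨x, a⟩, ha⟩ : ℍ)

theorem horocyclePath_injective (σ : PSL(2, ℝ)) {a : ℝ} (ha : 0 < a) :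
    Function.Injective (horocyclePath σ ha) := by
  intro x y h
  have h1 := MulAction.injective σ h
  exact congrArg UpperHalfPlane.re h1

theorem horocyclePath_image (σ : PSL(2, ℝ)) {a : ℝ} (ha : 0 < a) :
    horocyclePath σ ha '' Set.Icc 0 1 = σ • horocycle a := by
  ext w
  constructor
  · rintro ⟨x, hx, rfl⟩
    exact Set.smul_mem_smul_set ⟨hx, rfl⟩
  · rintro ⟨v, ⟨hv, hva⟩, rfl⟩
    refine ⟨v.re, hv, ?_⟩
    subst hva
    rfl

end

/-! ### Discrete subgroups of `PSL(2, ℝ)` -/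

/-! The identity is an unfolding along the cusp. In the coordinate `σ⁻¹`, an element of `Γ` amounts
to a coset `q` in `Γ_p \ Γ` together with an integer translation `n`
(`exists_cusp_representatives`). Write `x₀ + iy` for the representative of the orbit of `z` attached
to `q`, with `0 ≤ x₀ < 1`. By invariance of distance the Green term at `σ(x + ia)` is `Q_{s-1}` at
`1 + ((x + n - x₀)² + (a - y)²) / (2ay)`. Summing over `n` turns the integral over `[0, 1]` into one
over `ℝ`, and `integral_legendreQ` evaluates it as `2π / (2s - 1) · a^(1-s) · y^s`, a multiple of
the Eisenstein term of `q`.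

That evaluation inserts the integral for `Q` and integrates in `x` first. What remains is a
Gegenbauer-type integral with parameter `y / a < 1`, which does not depend on this parameter
(`integral_gegenbauer`); the constant is a product of two beta integrals
(`integral_mul_integral_eq`).

Convergence rests on discreteness: a hyperbolic ball of fixed radius holds boundedly many orbit
points, so a dyadic decomposition of the strip gives `∑ y^t < ∞` for `t > 1` (`summable_im_rpow`).
Hence the heights stay below some `b < a`, and `norm_legendreQ_horocycle_le` gives a majorant
summable over all pairs `(q, n)`, uniform on the horocycle. -/

instance : IsClosed (Subgroup.center SL(2, ℝ) : Set SL(2, ℝ)) := by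
  have h : (Subgroup.center SL(2, ℝ) : Set SL(2, ℝ)) = ⋂ g : SL(2, ℝ), {h | g * h = h * g} := by
    ext h
    simp [Subgroup.mem_center_iff]
  rw [h]
  exact isClosed_iInter fun g => isClosed_eq (by fun_prop) (by fun_prop)

theorem psl_dist_smul (g : PSL(2, ℝ)) (z w : ℍ) : dist (g • z) (g • w) = dist z w := by
  induction g using QuotientGroup.induction_on with
  | H g => exact dist_smul g z w

theorem isCompact_dist_smul_le (z : ℍ) (R : ℝ) :
    IsCompact {g : SL(2, ℝ) | dist (g • z) z ≤ R} := by
  have h := (ProperSMul.isProperMap_smul_pair (G := SL(2, ℝ)) (X := ℍ)).isCompact_preimage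
    ((isCompact_closedBall z R).prod (isCompact_singleton (x := z)))
  convert! h.image continuous_fst using 1
  ext g
  simp

/-- The action of `SL(2, ℝ)` on `ℍ` is proper, so the elements moving `z` by at most `R` form a
compact set, whose image in `PSL(2, ℝ)` meets a discrete subgroup in a finite set. -/
theorem finite_dist_smul_le (Γ : Subgroup PSL(2, ℝ)) [DiscreteTopology Γ] (z : ℍ) (R : ℝ) :
    {g : Γ | dist ((g : PSL(2, ℝ)) • z) z ≤ R}.Finite := by
  have : T2Space PSL(2, ℝ) := inferInstanceAs (T2Space (SL(2, ℝ) ⧸ Subgroup.center SL(2, ℝ)))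
  have h := Γ.tendsto_coe_cofinite_of_discrete ⟨inferInstance⟩
    ((isCompact_dist_smul_le z R).image
      (QuotientGroup.continuous_mk (N := Subgroup.center SL(2, ℝ)))).compl_mem_cocompact
  rw [Filter.mem_map, Filter.mem_cofinite, ← Set.preimage_compl, compl_compl] at h
  refine h.subset ?_
  rintro ⟨g, hg⟩ hgz
  obtain ⟨g, rfl⟩ := QuotientGroup.mk_surjective g
  exact ⟨g, hgz, rfl⟩

/-! ### Counting orbit points -/

theorem summable_comp_of_ncard_fiber_le {α β : Type*} (φ : α → β) {g : β → ℝ} (hg : Summable g)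
    (hg0 : ∀ b, 0 ≤ g b) (M : ℕ)
    (hM : ∀ a, {x | φ x = φ a}.Finite ∧ {x | φ x = φ a}.ncard ≤ M) :
    Summable (fun x => g (φ x)) := by
  classical
  refine summable_of_sum_le (c := M * ∑' b, g b) (fun x => hg0 _) fun S => ?_
  rw [← Finset.sum_fiberwise_of_maps_to (t := S.image φ) (g := φ)
    (fun x hx => Finset.mem_image_of_mem _ hx)]
  calc _ ≤ ∑ b ∈ S.image φ, M * g b := by
        refine Finset.sum_le_sum fun b hb => ?_
        obtain ⟨a, -, rfl⟩ := Finset.mem_image.1 hb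
        rw [Finset.sum_congr rfl (g := fun _ => g (φ a))
          (fun x hx => by rw [(Finset.mem_filter.1 hx).2]), Finset.sum_const, nsmul_eq_mul]
        refine mul_le_mul_of_nonneg_right ?_ (hg0 _)
        rw [← Set.ncard_coe_finset]
        have hsub : (({x ∈ S | φ x = φ a} : Finset α) : Set α) ⊆ {x | φ x = φ a} := by
          intro x
          simp
        exact_mod_cast (Set.ncard_le_ncard hsub (hM a).1).trans (hM a).2
    _ ≤ _ := by
        rw [← Finset.mul_sum]
        exact mul_le_mul_of_nonneg_left (hg.sum_le_tsum _ fun b _ => hg0 b) (by positivity)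

/-- Level `k` has `2^k` boxes and contributes `a^t · 2^((1-t)k)`, a geometric series. -/
theorem summable_dyadic_boxes {a t : ℝ} (ha : 0 < a) (ht : 1 < t) :
    Summable (fun b : Σ k : ℕ, Fin (2 ^ k) => (a / 2 ^ b.1) ^ t) := by
  rw [summable_sigma_of_nonneg (fun b => by positivity)]
  refine ⟨fun k => (hasSum_fintype _).summable, ?_⟩
  have h : ∀ k : ℕ, ∑' _ : Fin (2 ^ k), (a / 2 ^ k) ^ t = a ^ t * ((2 : ℝ) ^ (1 - t)) ^ k := by
    intro k
    rw [tsum_fintype, Finset.sum_const, Finset.card_univ, Fintype.card_fin, nsmul_eq_mul,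
      Real.div_rpow ha.le (by positivity), Real.rpow_sub two_pos, Real.rpow_one, div_pow,
      ← Real.rpow_natCast_mul (by norm_num), ← Real.rpow_mul_natCast (by norm_num), mul_comm t]
    push_cast
    ring
  simp only [h]
  refine (summable_geometric_of_lt_one (by positivity) ?_).mul_left _
  exact Real.rpow_lt_one_of_one_lt_of_neg (by norm_num) (by linarith)

/-- Coordinate differences are at most `2^(-k)` and `a · 2^(-k)`, while both heights are at least `a
/ 2^(k+1)`; the scale cancels in `|z - w|² / (2 Im z Im w)`. -/
theorem dist_le_of_mem_box {a : ℝ} (ha : 0 < a) {z w : ℍ} {k : ℕ}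
    (hx : |z.re - w.re| * 2 ^ k ≤ 1) (hz : z.im * 2 ^ k ≤ a) (hz' : a ≤ z.im * 2 ^ (k + 1))
    (hw : w.im * 2 ^ k ≤ a) (hw' : a ≤ w.im * 2 ^ (k + 1)) :
    dist z w ≤ Real.arcosh (1 + 2 * (1 + a ^ 2) / a ^ 2) := by
  have h0 := z.im_pos
  have h1 := w.im_pos
  have hN : (0 : ℝ) < 2 ^ k := by positivity
  rw [pow_succ] at hz' hw'
  generalize (2 : ℝ) ^ k = N at *
  rw [← Real.arcosh_cosh (dist_nonneg (x := z) (y := w)),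
    Real.arcosh_le_arcosh (Real.cosh_pos _) (by positivity), UpperHalfPlane.cosh_dist]
  gcongr 1 + ?_
  rw [div_le_div_iff₀ (by positivity) (by positivity), dist_eq_norm, Complex.sq_norm,
    Complex.normSq_apply]
  simp only [Complex.sub_re, Complex.sub_im, UpperHalfPlane.coe_re, UpperHalfPlane.coe_im]
  have h2 : (z.re - w.re) ^ 2 * N ^ 2 ≤ 1 := by
    rw [← sq_abs, ← mul_pow]
    exact pow_le_one₀ (by positivity) hx
  have h3 : (z.im - w.im) ^ 2 * N ^ 2 ≤ a ^ 2 := by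
    rw [← mul_pow]
    refine sq_le_sq' ?_ ?_ <;> nlinarith [mul_pos h0 hN, mul_pos h1 hN]
  have h4 : a * a ≤ (z.im * (N * 2)) * (w.im * (N * 2)) := mul_le_mul hz' hw' ha.le (by positivity)
  refine le_of_mul_le_mul_right ?_ (pow_pos hN 2)
  calc _ = ((z.re - w.re) ^ 2 * N ^ 2 + (z.im - w.im) ^ 2 * N ^ 2) * a ^ 2 := by ring
    _ ≤ (1 + a ^ 2) * (a * a) := by rw [← pow_two]; gcongr
    _ ≤ (1 + a ^ 2) * ((z.im * (N * 2)) * (w.im * (N * 2))) := by gcongr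
    _ = _ := by ring

/-- Points in the strip `0 ≤ Re < 1` of bounded height, with boundedly many of them in each
hyperbolic ball around one of them, have a convergent sum of powers of their heights. -/
theorem summable_im_rpow {Q : Type*} (ζ : Q → ℍ) {a t : ℝ} (ht : 1 < t)
    (hre : ∀ q, (ζ q).re ∈ Set.Ico (0 : ℝ) 1) (him : ∀ q, (ζ q).im < a)
    (hfin : ∀ R : ℝ, ∃ M : ℕ, ∀ q₀,
      {q | dist (ζ q) (ζ q₀) ≤ R}.Finite ∧ {q | dist (ζ q) (ζ q₀) ≤ R}.ncard ≤ M) :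
    Summable (fun q => (ζ q).im ^ t) := by
  rcases isEmpty_or_nonempty Q with hQ | ⟨⟨q₁⟩⟩
  · exact (hasSum_empty).summable
  have ha : 0 < a := (ζ q₁).im_pos.trans (him q₁)
  have hk (q : Q) : ∃ k : ℕ, (ζ q).im * 2 ^ k ≤ a ∧ a ≤ (ζ q).im * 2 ^ (k + 1) := by
    have h0 := (ζ q).im_pos
    obtain ⟨k, h1, h2⟩ := exists_nat_pow_near (x := a / (ζ q).im) (y := 2)
      ((one_le_div h0).2 (him q).le) (by norm_num)
    rw [le_div_iff₀ h0] at h1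
    rw [div_lt_iff₀ h0] at h2
    exact ⟨k, by linarith, by linarith⟩
  choose k hk1 hk2 using hk
  have hj (q : Q) : ⌊(ζ q).re * 2 ^ k q⌋₊ < 2 ^ k q := by
    have := mul_lt_mul_of_pos_right (hre q).2 (show (0 : ℝ) < 2 ^ k q by positivity)
    rw [Nat.floor_lt (mul_nonneg (hre q).1 (by positivity))]
    push_cast
    linarith
  -- The box of `q`: its dyadic height level, and which of the `2^k` equal subintervals of `[0, 1)`
  -- contains the real part.
  let φ (q : Q) : Σ k : ℕ, Fin (2 ^ k) := ⟨k q, ⟨_, hj q⟩⟩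
  obtain ⟨M, hM⟩ := hfin (Real.arcosh (1 + 2 * (1 + a ^ 2) / a ^ 2))
  have hφ (q₀ : Q) : {q | φ q = φ q₀} ⊆
      {q | dist (ζ q) (ζ q₀) ≤ Real.arcosh (1 + 2 * (1 + a ^ 2) / a ^ 2)} := by
    intro q hq
    obtain ⟨h1, h2⟩ : k q = k q₀ ∧ ⌊(ζ q).re * 2 ^ k q⌋₊ = ⌊(ζ q₀).re * 2 ^ k q₀⌋₊ := by
      have h : φ q = φ q₀ := hq
      have h3 := congrArg (fun b => (b.2 : ℕ)) h
      exact ⟨congrArg Sigma.fst h, h3⟩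
    refine dist_le_of_mem_box ha (k := k q) ?_ (hk1 q) (hk2 q) (h1 ▸ hk1 q₀) (h1 ▸ hk2 q₀)
    rw [← h1] at h2
    have h3 := Nat.floor_le (mul_nonneg (hre q).1 (by positivity : (0 : ℝ) ≤ 2 ^ k q))
    have h4 := Nat.floor_le (mul_nonneg (hre q₀).1 (by positivity : (0 : ℝ) ≤ 2 ^ k q))
    have h5 := Nat.lt_floor_add_one ((ζ q).re * 2 ^ k q)
    have h6 := Nat.lt_floor_add_one ((ζ q₀).re * 2 ^ k q)
    rw [h2] at h3 h5
    rw [← abs_of_nonneg (by positivity : (0 : ℝ) ≤ 2 ^ k q), ← abs_mul, abs_le]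
    constructor <;> nlinarith
  refine Summable.of_nonneg_of_le (fun q => Real.rpow_nonneg (ζ q).im_pos.le _) (fun q => ?_)
    (summable_comp_of_ncard_fiber_le φ (summable_dyadic_boxes ha ht)
      (fun b => by positivity) M fun q => ⟨(hM q).1.subset (hφ q),
        (Set.ncard_le_ncard (hφ q) (hM q).1).trans (hM q).2⟩)
  refine Real.rpow_le_rpow (ζ q).im_pos.le ?_ (by linarith)
  rw [le_div_iff₀ (by positivity)]
  exact hk1 q

/-! ### The two beta integrals -/

theorem ofReal_sq_cpow {x : ℝ} (hx : 0 < x) (s : ℂ) : ((x ^ 2 : ℝ) : ℂ) ^ s = (x : ℂ) ^ (2 * s) := by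
  rw [two_mul, Complex.cpow_add _ _ (by exact_mod_cast hx.ne'), pow_two, Complex.ofReal_mul,
    Complex.mul_cpow_ofReal_nonneg hx.le hx.le]

theorem integral_one_sub_sq_cpow (s : ℂ) :
    ∫ t in (-1 : ℝ)..1, ((1 - t ^ 2 : ℝ) : ℂ) ^ (s - 1) =
      (2 : ℂ) ^ (2 * s - 1) * Complex.betaIntegral s s := by
  have h := intervalIntegral.integral_comp_mul_add
    (fun t : ℝ => ((1 - t ^ 2 : ℝ) : ℂ) ^ (s - 1)) (a := 0) (b := 1) (c := 2) two_ne_zero (-1)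
  norm_num at h
  have h2 : ∫ t in (-1 : ℝ)..1, ((1 - t ^ 2 : ℝ) : ℂ) ^ (s - 1) =
      2 * ∫ x in (0 : ℝ)..1, ((1 - (2 * x + -1) ^ 2 : ℝ) : ℂ) ^ (s - 1) := by
    push_cast at h ⊢
    rw [h]; ring
  rw [h2, Complex.betaIntegral, ← intervalIntegral.integral_const_mul,
    ← intervalIntegral.integral_const_mul]
  refine intervalIntegral.integral_congr fun x hx => ?_
  rw [Set.uIcc_of_le zero_le_one] at hx
  have h3 : 1 - (2 * x + -1) ^ 2 = (2 ^ 2 : ℝ) * (x * (1 - x)) := by ring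
  rw [h3, Complex.ofReal_mul, Complex.mul_cpow_ofReal_nonneg (by norm_num)
    (mul_nonneg hx.1 (by linarith [hx.2])), ofReal_sq_cpow two_pos, Complex.ofReal_mul,
    Complex.mul_cpow_ofReal_nonneg hx.1 (by linarith [hx.2])]
  have h4 : (2 : ℂ) ^ (2 * s - 1) = 2 * (2 : ℂ) ^ (2 * (s - 1)) := by
    rw [show 2 * s - 1 = 1 + 2 * (s - 1) by ring, Complex.cpow_add _ _ two_ne_zero, Complex.cpow_one]
  rw [h4]
  push_cast
  ring

theorem hasDerivAt_div_sqrt_one_sub_sq {v : ℝ} (hv : v ∈ Set.Ioo (-1 : ℝ) 1) :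
    HasDerivAt (fun v : ℝ => v / √(1 - v ^ 2)) (√(1 - v ^ 2) ^ (-3 : ℤ)) v := by
  have h0 : 0 < 1 - v ^ 2 := by nlinarith [hv.1, hv.2]
  have h1 : HasDerivAt (fun v : ℝ => 1 - v ^ 2) (-(2 * v)) v := by
    simpa using (hasDerivAt_pow 2 v).const_sub 1
  have h2 := (hasDerivAt_id v).div (h1.sqrt h0.ne') (Real.sqrt_pos.2 h0).ne'
  refine h2.congr_deriv ?_
  have h3 := Real.sq_sqrt h0.le
  have h4 := Real.sqrt_pos.2 h0
  simp only [id]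
  rw [zpow_neg]
  field_simp
  norm_cast
  rw [h3]
  ring

theorem div_sqrt_one_sub_sq_sq_add_one {v : ℝ} (hv : v ∈ Set.Ioo (-1 : ℝ) 1) :
    (v / √(1 - v ^ 2)) ^ 2 + 1 = (√(1 - v ^ 2) ^ 2)⁻¹ := by
  have h0 : 0 < 1 - v ^ 2 := by nlinarith [hv.1, hv.2]
  rw [div_pow, Real.sq_sqrt h0.le]
  field_simp
  ring

/-- Substituting `x = v / √(1 - v²)` gives `x² + 1 = (1 - v²)⁻¹` and `dx = (1 - v²)^(-3/2) dv`. -/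
theorem integral_one_add_sq_cpow (s : ℂ) :
    ∫ x : ℝ, ((x ^ 2 + 1 : ℝ) : ℂ) ^ (-s) =
      ∫ v in (-1 : ℝ)..1, ((1 - v ^ 2 : ℝ) : ℂ) ^ (s - 1 / 2 - 1) := by
  have hinj : Set.InjOn (fun v : ℝ => v / √(1 - v ^ 2)) (Set.Ioo (-1) 1) := by
    intro v hv w hw hvw
    have h0 : 0 < 1 - w ^ 2 := by nlinarith [hw.1, hw.2]
    have h1 := div_sqrt_one_sub_sq_sq_add_one hv
    have h2 : v / √(1 - v ^ 2) = w / √(1 - w ^ 2) := hvw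
    rw [h2, div_sqrt_one_sub_sq_sq_add_one hw, inv_inj,
      sq_eq_sq₀ (Real.sqrt_nonneg _) (Real.sqrt_nonneg _)] at h1
    rwa [← h1, div_left_inj' (h1 ▸ (Real.sqrt_pos.2 h0).ne')] at h2
  have himg : (fun v : ℝ => v / √(1 - v ^ 2)) '' (Set.Ioo (-1) 1) = Set.univ := by
    refine Set.eq_univ_of_forall fun x => ?_
    have h1 : 0 < 1 + x ^ 2 := by positivity
    have h2 : |x| < √(1 + x ^ 2) := Real.lt_sqrt_of_sq_lt (by rw [sq_abs]; linarith)
    refine ⟨x / √(1 + x ^ 2), ⟨?_, ?_⟩, ?_⟩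
    · rw [lt_div_iff₀ (by positivity)]; linarith [(abs_lt.1 h2).1]
    · rw [div_lt_iff₀ (by positivity)]; linarith [(abs_lt.1 h2).2]
    · have h3 : 1 - (x / √(1 + x ^ 2)) ^ 2 = (√(1 + x ^ 2) ^ 2)⁻¹ := by
        have h5 : √(1 + x ^ 2) ^ 2 = 1 + x ^ 2 := Real.sq_sqrt h1.le
        rw [div_pow, h5]
        field_simp
        ring
      simp only
      rw [h3, Real.sqrt_inv, Real.sqrt_sq (by positivity)]
      field_simp
  rw [← setIntegral_univ, ← himg, integral_image_eq_integral_abs_deriv_smul measurableSet_Ioo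
    (fun v hv => (hasDerivAt_div_sqrt_one_sub_sq hv).hasDerivWithinAt) hinj,
    intervalIntegral.integral_of_le (by norm_num), integral_Ioc_eq_integral_Ioo]
  refine setIntegral_congr_fun measurableSet_Ioo fun v hv => ?_
  have h0 : 0 < 1 - v ^ 2 := by nlinarith [hv.1, hv.2]
  have h4 := Real.sqrt_pos.2 h0
  have h3 : ((1 - v ^ 2 : ℝ) : ℂ) = ((√(1 - v ^ 2) ^ 2 : ℝ) : ℂ) := by
    rw [Real.sq_sqrt h0.le]
  rw [div_sqrt_one_sub_sq_sq_add_one hv, abs_of_pos (by positivity), h3]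
  set r := √(1 - v ^ 2)
  rw [Complex.ofReal_inv, Complex.inv_cpow _ _ (by
      rw [Complex.arg_ofReal_of_nonneg (by positivity)]; exact Real.pi_pos.ne), ← Complex.cpow_neg,
    neg_neg, ofReal_sq_cpow h4, ofReal_sq_cpow h4, Complex.real_smul, Complex.ofReal_zpow,
    ← Complex.cpow_intCast, ← Complex.cpow_add _ _ (by exact_mod_cast h4.ne')]
  congr 1
  push_cast
  ring

/-- Both factors are beta values, `B(s - 1/2, s - 1/2)` and `B(s, s)` up to powers of 2. Legendre
duplication for `Γ(s - 1/2) Γ(s)` and `Γ(2s) = (2s - 1) Γ(2s - 1)` cancel every Gamma factor. -/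
theorem integral_mul_integral_eq {s : ℂ} (hs : 1 / 2 < s.re) :
    (∫ x : ℝ, ((x ^ 2 + 1 : ℝ) : ℂ) ^ (-s)) * ∫ t in (-1 : ℝ)..1, ((1 - t ^ 2 : ℝ) : ℂ) ^ (s - 1) =
      2 * Real.pi / (2 * s - 1) := by
  have hs0 : 0 < s.re := by linarith
  have hs1 : 0 < (s - 1 / 2).re := by
    rw [Complex.sub_re]; norm_num; linarith
  have hs2 : 0 < (2 * s - 1).re := by simp; linarith
  rw [integral_one_add_sq_cpow, integral_one_sub_sq_cpow, integral_one_sub_sq_cpow]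
  have hB1 := Complex.Gamma_mul_Gamma_eq_betaIntegral hs0 hs0
  have hB2 := Complex.Gamma_mul_Gamma_eq_betaIntegral hs1 hs1
  have hd := Complex.Gamma_mul_Gamma_add_half (s - 1 / 2)
  have hG := Complex.Gamma_add_one (2 * s - 1) (by intro h; rw [h] at hs2; simp at hs2)
  have hG0 := Complex.Gamma_ne_zero_of_re_pos hs2
  have hne : 2 * s - 1 ≠ 0 := by intro h; rw [h] at hs2; simp at hs2
  rw [show s + s = 2 * s - 1 + 1 by ring, hG] at hB1
  rw [show s - 1 / 2 + (s - 1 / 2) = 2 * s - 1 by ring] at hB2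
  rw [show s - 1 / 2 + 1 / 2 = s by ring, show 2 * (s - 1 / 2) = 2 * s - 1 by ring]
    at hd
  have hpi : ((√Real.pi : ℝ) : ℂ) ^ 2 = Real.pi := by
    rw [← Complex.ofReal_pow, Real.sq_sqrt Real.pi_pos.le]
  have h2 : (2 : ℂ) ^ (2 * (s - 1 / 2) - 1) * (2 : ℂ) ^ (2 * s - 1) * ((2 : ℂ) ^ (1 - (2 * s - 1))) ^ 2
      = 2 := by
    rw [← Complex.cpow_nat_mul, ← Complex.cpow_add _ _ two_ne_zero,
      ← Complex.cpow_add _ _ two_ne_zero]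
    conv_rhs => rw [← Complex.cpow_one 2]
    congr 1
    push_cast
    ring
  rw [eq_div_iff hne]
  refine mul_left_cancel₀ (pow_ne_zero 2 hG0) ?_
  linear_combination (-(2 : ℂ) ^ (2 * (s - 1 / 2) - 1) * (2 : ℂ) ^ (2 * s - 1)) *
    (Complex.Gamma (2 * s - 1) * Complex.betaIntegral (s - 1 / 2) (s - 1 / 2) * hB1
      + Complex.Gamma s * Complex.Gamma s * hB2 - (Complex.Gamma (s - 1 / 2) * Complex.Gamma s +
        Complex.Gamma (2 * s - 1) * 2 ^ (1 - (2 * s - 1)) * √Real.pi) * hd)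
    + (Complex.Gamma (2 * s - 1)) ^ 2 * ((√Real.pi : ℝ) : ℂ) ^ 2 * h2
    + 2 * (Complex.Gamma (2 * s - 1)) ^ 2 * hpi

/-! ### The Legendre function of the second kind -/

theorem continuous_one_sub_sq_cpow {s : ℂ} (hs : 1 < s.re) :
    Continuous fun t : ℝ => ((1 - t ^ 2 : ℝ) : ℂ) ^ (s - 1) :=
  (Complex.continuous_ofReal_cpow_const (by simpa using hs)).comp (by fun_prop)

theorem norm_one_sub_sq_cpow_le_one {s : ℂ} (hs : 1 < s.re) {t : ℝ} (ht : t ∈ Set.Icc (-1 : ℝ) 1) :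
    ‖((1 - t ^ 2 : ℝ) : ℂ) ^ (s - 1)‖ ≤ 1 := by
  have h0 : 0 ≤ 1 - t ^ 2 := by nlinarith [ht.1, ht.2]
  rw [Complex.norm_cpow_eq_rpow_re_of_nonneg h0 (by simp; linarith)]
  exact Real.rpow_le_one h0 (by nlinarith) (by simp; linarith)

theorem norm_legendre_integrand_le {s : ℂ} (hs : 1 < s.re) {X t c : ℝ} (hc : 0 < c)
    (hX : 1 + c ≤ X) (ht : t ∈ Set.Icc (-1 : ℝ) 1) :
    ‖((1 - t ^ 2 : ℝ) : ℂ) ^ (s - 1) * ((X - t : ℝ) : ℂ) ^ (-s)‖ ≤ c ^ (-s.re) := by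
  have h1 : c ≤ X - t := by linarith [ht.2]
  rw [norm_mul, Complex.norm_cpow_eq_rpow_re_of_pos (hc.trans_le h1), Complex.neg_re]
  calc _ ≤ 1 * c ^ (-s.re) := by
        exact mul_le_mul (norm_one_sub_sq_cpow_le_one hs ht)
          (Real.rpow_le_rpow_of_nonpos hc h1 (by linarith)) (Real.rpow_nonneg (by linarith) _)
          zero_le_one
    _ = _ := one_mul _

theorem legendreQ_sub_one (s : ℂ) (X : ℝ) :
    legendreQ (s - 1) X = (2 : ℂ) ^ (-s) *
      ∫ t in (-1 : ℝ)..1, ((1 - t ^ 2 : ℝ) : ℂ) ^ (s - 1) * ((X - t : ℝ) : ℂ) ^ (-s) := by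
  rw [legendreQ, show -(s - 1) - 1 = -s by ring]

theorem norm_legendreQ_le {s : ℂ} (hs : 1 < s.re) {c : ℝ} (hc : 0 < c) :
    ‖legendreQ (s - 1) (1 + c)‖ ≤ 2 * c ^ (-s.re) := by
  rw [legendreQ_sub_one, norm_mul]
  have h1 : ‖(2 : ℂ) ^ (-s)‖ ≤ 1 := by
    rw [show (2 : ℂ) = ((2 : ℝ) : ℂ) by norm_num, Complex.norm_cpow_eq_rpow_re_of_pos two_pos]
    exact Real.rpow_le_one_of_one_le_of_nonpos (by norm_num) (by simp; linarith)
  have h2 := intervalIntegral.norm_integral_le_of_norm_le_const (a := -1) (b := 1)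
    (f := fun t : ℝ => ((1 - t ^ 2 : ℝ) : ℂ) ^ (s - 1) * ((1 + c - t : ℝ) : ℂ) ^ (-s))
    (C := c ^ (-s.re)) (fun t ht => by
      rw [Set.uIoc_of_le (by norm_num)] at ht
      exact norm_legendre_integrand_le hs hc le_rfl ⟨ht.1.le, ht.2⟩)
  calc _ ≤ 1 * (c ^ (-s.re) * |1 - (-1)|) := by gcongr
    _ = _ := by norm_num; ring

theorem continuousOn_legendre_integrand {s : ℂ} (hs : 1 < s.re) {X : ℝ} (hX : 1 < X) :
    ContinuousOn (fun t : ℝ => ((1 - t ^ 2 : ℝ) : ℂ) ^ (s - 1) * ((X - t : ℝ) : ℂ) ^ (-s))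
      (Set.Icc (-1) 1) := by
  refine (continuous_one_sub_sq_cpow hs).continuousOn.mul ?_
  refine ContinuousOn.cpow_const (by fun_prop) fun t ht => ?_
  exact Complex.ofReal_mem_slitPlane.2 (by linarith [ht.2])

theorem continuousOn_legendreQ {s : ℂ} (hs : 1 < s.re) :
    ContinuousOn (legendreQ (s - 1)) (Set.Ioi 1) := by
  intro X hX
  have hX : 1 < X := hX
  simp only [funext (legendreQ_sub_one s)]
  refine (continuousAt_const.mul ?_).continuousWithinAt
  have hnhds : ∀ᶠ Y in nhds X, 1 + (X - 1) / 2 ≤ Y :=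
    (lt_mem_nhds (show 1 + (X - 1) / 2 < X by linarith)).mono fun _ h => h.le
  refine intervalIntegral.continuousAt_of_dominated_interval
    (bound := fun _ => ((X - 1) / 2) ^ (-s.re)) ?_ ?_ intervalIntegrable_const ?_
  · filter_upwards [hnhds] with Y hY
    rw [Set.uIoc_of_le (by norm_num)]
    exact ((continuousOn_legendre_integrand hs (by linarith)).mono
      Set.Ioc_subset_Icc_self).aestronglyMeasurable measurableSet_Ioc
  · filter_upwards [hnhds] with Y hY
    refine Filter.Eventually.of_forall fun t ht => ?_
    rw [Set.uIoc_of_le (by norm_num)] at ht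
    exact norm_legendre_integrand_le hs (by linarith) hY ⟨ht.1.le, ht.2⟩
  · refine Filter.Eventually.of_forall fun t ht => ?_
    rw [Set.uIoc_of_le (by norm_num)] at ht
    refine continuousAt_const.mul ?_
    refine ContinuousAt.cpow (by fun_prop) continuousAt_const ?_
    exact Complex.ofReal_mem_slitPlane.2 (by linarith [ht.2])

/-! ### The integral over a horocycle -/

theorem integral_sq_add_cpow (s : ℂ) {A : ℝ} (hA : 0 < A) :
    ∫ x : ℝ, ((x ^ 2 + A : ℝ) : ℂ) ^ (-s) =
      (A : ℂ) ^ (1 / 2 - s) * ∫ x : ℝ, ((x ^ 2 + 1 : ℝ) : ℂ) ^ (-s) := by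
  have hr := Real.sqrt_pos.2 hA
  have h := Measure.integral_comp_mul_left (fun x : ℝ => ((x ^ 2 + A : ℝ) : ℂ) ^ (-s)) √A
  rw [abs_of_pos (inv_pos.2 hr), eq_inv_smul_iff₀ hr.ne'] at h
  rw [← h, ← integral_const_mul, ← integral_smul]
  refine integral_congr_ae (Filter.Eventually.of_forall fun x => ?_)
  have h1 : (√A * x) ^ 2 + A = A * (x ^ 2 + 1) := by
    rw [mul_pow, Real.sq_sqrt hA.le]; ring
  have h2 : ((√A : ℝ) : ℂ) = (A : ℂ) ^ (1 / 2 : ℂ) := by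
    rw [Real.sqrt_eq_rpow, Complex.ofReal_cpow hA.le]
    norm_num
  simp only
  rw [h1, Complex.ofReal_mul, Complex.mul_cpow_ofReal_nonneg hA.le (by positivity),
    Complex.real_smul, h2, sub_eq_add_neg, Complex.cpow_add _ _ (by exact_mod_cast hA.ne')]
  ring

section Gegenbauer

variable {r : ℝ}

/-- Geometrically, `ρ = √(1 - r² + (rv)²) - rv` is the distance from the point at height `r` on the
axis to the unit sphere, in the direction making an angle of cosine `v` with the axis; `r + vρ` is
the axial coordinate of the point reached. -/
theorem hasDerivAt_chord (hr : r ∈ Set.Ico (0 : ℝ) 1) (v : ℝ) :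
    HasDerivAt (fun v : ℝ => r + v * (√(1 - r ^ 2 + (r * v) ^ 2) - r * v))
      ((√(1 - r ^ 2 + (r * v) ^ 2) - r * v) ^ 2 / √(1 - r ^ 2 + (r * v) ^ 2)) v := by
  have h0 : 0 < 1 - r ^ 2 + (r * v) ^ 2 := by nlinarith [hr.1, hr.2, sq_nonneg (r * v)]
  have h1 : HasDerivAt (fun v : ℝ => 1 - r ^ 2 + (r * v) ^ 2) (2 * (r * v) * r) v := by
    have := (((hasDerivAt_id v).const_mul r).pow 2).const_add (1 - r ^ 2)
    simpa using this
  have h2 := ((hasDerivAt_id v).mul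
    ((h1.sqrt h0.ne').sub ((hasDerivAt_id v).const_mul r))).const_add r
  refine h2.congr_deriv ?_
  have h3 := Real.sqrt_pos.2 h0
  change 1 * (√(1 - r ^ 2 + (r * v) ^ 2) - r * v) +
    v * (2 * (r * v) * r / (2 * √(1 - r ^ 2 + (r * v) ^ 2)) - r * 1) = _
  generalize √(1 - r ^ 2 + (r * v) ^ 2) = W at h3 ⊢
  field_simp
  ring

/-- With `t = r + vρ`, one has `1 + r² - 2rt = ρ²`, `1 - t² = (1 - v²)ρ²` and `dt = ρ²/W dv`, where
`W = ρ + rv`. The integrand becomes `(1 - v²)^(s-1) (1 - rv/W)`, and the part with `rv/W` is odd. -/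
theorem integral_gegenbauer {s : ℂ} (hs : 1 < s.re) (hr : r ∈ Set.Ico (0 : ℝ) 1) :
    ∫ t in (-1 : ℝ)..1, ((1 - t ^ 2 : ℝ) : ℂ) ^ (s - 1) *
      ((1 + r ^ 2 - 2 * r * t : ℝ) : ℂ) ^ (1 / 2 - s) =
    ∫ t in (-1 : ℝ)..1, ((1 - t ^ 2 : ℝ) : ℂ) ^ (s - 1) := by
  obtain ⟨hr0, hr1⟩ := hr
  have hW0 (v : ℝ) : 0 < 1 - r ^ 2 + (r * v) ^ 2 := by nlinarith [sq_nonneg (r * v)]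
  have hW (v : ℝ) : 0 < √(1 - r ^ 2 + (r * v) ^ 2) := Real.sqrt_pos.2 (hW0 v)
  have hρ (v : ℝ) : 0 < √(1 - r ^ 2 + (r * v) ^ 2) - r * v := by
    rw [sub_pos]
    exact Real.lt_sqrt_of_sq_lt (by nlinarith)
  have hWc : Continuous fun v : ℝ => √(1 - r ^ 2 + (r * v) ^ 2) := by fun_prop
  have h1 := intervalIntegral.integral_deriv_smul_comp' (a := -1) (b := 1)
    (g := fun t : ℝ => ((1 - t ^ 2 : ℝ) : ℂ) ^ (s - 1) *
      ((1 + r ^ 2 - 2 * r * t : ℝ) : ℂ) ^ (1 / 2 - s))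
    (fun v _ => hasDerivAt_chord ⟨hr0, hr1⟩ v)
    (Continuous.continuousOn (by
      exact ((hWc.sub (by fun_prop)).pow 2).div hWc fun v => (hW v).ne'))
    (by
      refine (continuous_one_sub_sq_cpow hs).continuousOn.mul ?_
      refine ContinuousOn.cpow_const (by fun_prop) ?_
      rintro _ ⟨v, -, rfl⟩
      refine Complex.ofReal_mem_slitPlane.2 ?_
      have h := Real.sq_sqrt (hW0 v).le
      have : 1 + r ^ 2 - 2 * r * (r + v * (√(1 - r ^ 2 + (r * v) ^ 2) - r * v)) =
        (√(1 - r ^ 2 + (r * v) ^ 2) - r * v) ^ 2 := by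
          linear_combination -h
      rw [this]
      exact pow_pos (hρ v) 2)
  have e1 : √(1 - r ^ 2 + (r * 1) ^ 2) = 1 := by norm_num
  have e2 : √(1 - r ^ 2 + (r * (-1)) ^ 2) = 1 := by norm_num
  rw [e1, e2] at h1
  rw [show r + 1 * (1 - r * 1) = 1 by ring, show r + -1 * (1 - r * -1) = -1 by ring] at h1
  rw [← h1]
  have hint : Continuous fun v : ℝ =>
      ((1 - v ^ 2 : ℝ) : ℂ) ^ (s - 1) * ((r * v / √(1 - r ^ 2 + (r * v) ^ 2) : ℝ) : ℂ) := by
    refine (continuous_one_sub_sq_cpow hs).mul (Complex.continuous_ofReal.comp ?_)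
    exact Continuous.div (by fun_prop) hWc fun v => (hW v).ne'
  have hodd : ∫ v in (-1 : ℝ)..1,
      ((1 - v ^ 2 : ℝ) : ℂ) ^ (s - 1) * ((r * v / √(1 - r ^ 2 + (r * v) ^ 2) : ℝ) : ℂ) = 0 := by
    have h := intervalIntegral.integral_comp_neg (a := -1) (b := 1) (fun v : ℝ =>
      ((1 - v ^ 2 : ℝ) : ℂ) ^ (s - 1) * ((r * v / √(1 - r ^ 2 + (r * v) ^ 2) : ℝ) : ℂ))
    simp only [mul_neg, neg_div, neg_sq, Complex.ofReal_neg, intervalIntegral.integral_neg,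
      neg_neg] at h
    exact self_eq_neg.1 h.symm
  rw [← sub_zero (∫ t in (-1 : ℝ)..1, ((1 - t ^ 2 : ℝ) : ℂ) ^ (s - 1)), ← hodd,
    ← intervalIntegral.integral_sub ((continuous_one_sub_sq_cpow hs).intervalIntegrable _ _)
      (hint.intervalIntegrable _ _)]
  refine intervalIntegral.integral_congr fun v hv => ?_
  rw [Set.uIcc_of_le (by norm_num)] at hv
  have hv0 : 0 ≤ 1 - v ^ 2 := by nlinarith [hv.1, hv.2]
  have h := Real.sq_sqrt (hW0 v).le
  have hw := hW v
  have hp := hρ v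
  simp only [Function.comp]
  set W := √(1 - r ^ 2 + (r * v) ^ 2)
  have e3 : 1 + r ^ 2 - 2 * r * (r + v * (W - r * v)) = (W - r * v) ^ 2 := by
    linear_combination -h
  have e4 : 1 - (r + v * (W - r * v)) ^ 2 = (1 - v ^ 2) * (W - r * v) ^ 2 := by
    linear_combination -h
  have e5 : ((W - r * v : ℝ) : ℂ) ^ (2 * (s - 1)) * ((W - r * v : ℝ) : ℂ) ^ (2 * (1 / 2 - s)) =
      ((W - r * v : ℝ) : ℂ)⁻¹ := by
    rw [← Complex.cpow_add _ _ (by exact_mod_cast hp.ne'), ← Complex.cpow_neg_one]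
    congr 1
    ring
  rw [e3, e4, Complex.ofReal_mul, Complex.mul_cpow_ofReal_nonneg hv0 (by positivity),
    ofReal_sq_cpow hp, ofReal_sq_cpow hp, mul_assoc, e5, Complex.real_smul]
  have hp' : ((W - r * v : ℝ) : ℂ) ≠ 0 := by exact_mod_cast hp.ne'
  have hw' : (W : ℂ) ≠ 0 := by exact_mod_cast hw.ne'
  push_cast at hp' ⊢
  field_simp

end Gegenbauer

theorem exists_sq_add_rpow_le {δ t : ℝ} (hδ : 0 < δ) (ht : 1 < t) :
    ∃ C : ℝ, 0 ≤ C ∧ ∀ x : ℝ, (x ^ 2 + δ) ^ (-t) ≤ C * (1 + x ^ 2)⁻¹ := by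
  have hm : 0 < min δ 1 := by positivity
  refine ⟨(min δ 1)⁻¹ * δ ^ (1 - t), by positivity, fun x => ?_⟩
  have h0 : 0 < x ^ 2 + δ := by positivity
  calc (x ^ 2 + δ) ^ (-t) = (x ^ 2 + δ)⁻¹ * (x ^ 2 + δ) ^ (1 - t) := by
        rw [← Real.rpow_neg_one, ← Real.rpow_add h0]
        ring_nf
    _ ≤ (min δ 1 * (1 + x ^ 2))⁻¹ * δ ^ (1 - t) := by
        refine mul_le_mul (inv_anti₀ (by positivity) ?_)
          (Real.rpow_le_rpow_of_nonpos hδ (by nlinarith) (by linarith)) (by positivity)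
          (by positivity)
        nlinarith [min_le_left δ 1, min_le_right δ 1, sq_nonneg x]
    _ = _ := by rw [mul_inv]; ring

theorem integrable_sq_add_rpow {δ t : ℝ} (hδ : 0 < δ) (ht : 1 < t) :
    Integrable fun x : ℝ => (x ^ 2 + δ) ^ (-t) := by
  obtain ⟨C, -, hC⟩ := exists_sq_add_rpow_le hδ ht
  refine (integrable_inv_one_add_sq.const_mul C).mono' ?_ (Filter.Eventually.of_forall fun x => ?_)
  · exact (Continuous.rpow_const (by fun_prop)
      fun x => Or.inl (by positivity)).aestronglyMeasurable
  · rw [Real.norm_of_nonneg (by positivity)]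
    exact hC x

/-- This justifies Fubini: the majorant `((x² + δ)/κ)^(-Re s)` does not involve `t`, which ranges
over a set of finite measure. -/
theorem integrable_legendre_integrand {s : ℂ} (hs : 1 < s.re) {δ κ : ℝ} (hδ : 0 < δ) (hκ : 0 < κ) :
    Integrable (Function.uncurry fun x t : ℝ => ((1 - t ^ 2 : ℝ) : ℂ) ^ (s - 1) *
      ((1 + (x ^ 2 + δ) / κ - t : ℝ) : ℂ) ^ (-s))
      (volume.prod (volume.restrict (Set.Ioc (-1 : ℝ) 1))) := by
  have hb : Integrable (fun x : ℝ => ((x ^ 2 + δ) / κ) ^ (-s.re)) := by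
    refine ((integrable_sq_add_rpow hδ hs).div_const (κ ^ (-s.re))).congr
      (Filter.Eventually.of_forall fun x => ?_)
    exact (Real.div_rpow (by positivity) hκ.le _).symm
  refine (hb.comp_fst (volume.restrict (Set.Ioc (-1 : ℝ) 1))).mono' ?_ ?_
  · refine Measurable.aestronglyMeasurable ?_
    unfold Function.uncurry
    fun_prop
  · have h : ∀ᵐ p ∂(volume : Measure ℝ).prod (volume.restrict (Set.Ioc (-1 : ℝ) 1)),
        p ∈ Set.univ ×ˢ Set.Ioc (-1 : ℝ) 1 := by
      rw [← Measure.restrict_univ (μ := (volume : Measure ℝ)), Measure.prod_restrict]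
      exact ae_restrict_mem (MeasurableSet.univ.prod measurableSet_Ioc)
    filter_upwards [h] with p hp
    exact norm_legendre_integrand_le hs (by positivity) le_rfl ⟨hp.2.1.le, hp.2.2⟩

theorem integrable_legendreQ {s : ℂ} (hs : 1 < s.re) {a y : ℝ} (hy : 0 < y) (hya : y < a)
    (x₀ : ℝ) :
    Integrable fun x : ℝ => legendreQ (s - 1) (1 + ((x - x₀) ^ 2 + (a - y) ^ 2) / (2 * a * y)) := by
  have ha := hy.trans hya
  refine Integrable.comp_sub_right
    (f := fun x => legendreQ (s - 1) (1 + (x ^ 2 + (a - y) ^ 2) / (2 * a * y))) ?_ x₀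
  simp only [legendreQ_sub_one, intervalIntegral.integral_of_le (show (-1 : ℝ) ≤ 1 by norm_num)]
  exact (integrable_legendre_integrand hs (pow_pos (sub_pos.2 hya) 2)
    (by positivity)).integral_prod_left.const_mul _

theorem integral_legendreQ {s : ℂ} (hs : 1 < s.re) {a y : ℝ} (hy : 0 < y) (hya : y < a) (x₀ : ℝ) :
    ∫ x : ℝ, legendreQ (s - 1) (1 + ((x - x₀) ^ 2 + (a - y) ^ 2) / (2 * a * y)) =
      2 * Real.pi / (2 * s - 1) * (a : ℂ) ^ (1 - s) * (y : ℂ) ^ s := by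
  have ha := hy.trans hya
  have hκ : 0 < 2 * a * y := by positivity
  have hδ := pow_pos (sub_pos.2 hya) 2
  rw [integral_sub_right_eq_self
    (fun x => legendreQ (s - 1) (1 + (x ^ 2 + (a - y) ^ 2) / (2 * a * y))) x₀]
  simp only [legendreQ_sub_one, intervalIntegral.integral_of_le (show (-1 : ℝ) ≤ 1 by norm_num)]
  rw [integral_const_mul, integral_integral_swap (integrable_legendre_integrand hs hδ hκ)]
  have hr : y / a ∈ Set.Ico (0 : ℝ) 1 := ⟨by positivity, (div_lt_one ha).2 hya⟩
  have hinner : ∀ t ∈ Set.Ioc (-1 : ℝ) 1,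
      ∫ x : ℝ, ((1 - t ^ 2 : ℝ) : ℂ) ^ (s - 1) *
        ((1 + (x ^ 2 + (a - y) ^ 2) / (2 * a * y) - t : ℝ) : ℂ) ^ (-s) =
      (((2 * a * y)⁻¹ : ℝ) : ℂ) ^ (-s) * (a : ℂ) ^ (2 * (1 / 2 - s)) *
        (∫ x : ℝ, ((x ^ 2 + 1 : ℝ) : ℂ) ^ (-s)) * (((1 - t ^ 2 : ℝ) : ℂ) ^ (s - 1) *
        ((1 + (y / a) ^ 2 - 2 * (y / a) * t : ℝ) : ℂ) ^ (1 / 2 - s)) := by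
    intro t ht
    have hA : 0 < (a - y) ^ 2 + 2 * a * y * (1 - t) :=
      add_pos_of_pos_of_nonneg hδ (mul_nonneg hκ.le (by linarith [ht.2]))
    -- Here the Gegenbauer kernel with `r = y / a` appears; `y < a` is what makes `r < 1`.
    have hA' : (a - y) ^ 2 + 2 * a * y * (1 - t) =
        a ^ 2 * (1 + (y / a) ^ 2 - 2 * (y / a) * t) := by
      field_simp
      ring
    have hD : 0 < 1 + (y / a) ^ 2 - 2 * (y / a) * t := by
      rw [hA'] at hA
      exact pos_of_mul_pos_right hA (by positivity)
    have hbase (x : ℝ) : ((1 + (x ^ 2 + (a - y) ^ 2) / (2 * a * y) - t : ℝ) : ℂ) ^ (-s) =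
        (((2 * a * y)⁻¹ : ℝ) : ℂ) ^ (-s) *
          ((x ^ 2 + ((a - y) ^ 2 + 2 * a * y * (1 - t)) : ℝ) : ℂ) ^ (-s) := by
      rw [← Complex.mul_cpow_ofReal_nonneg (by positivity) (by positivity), ← Complex.ofReal_mul]
      congr 2
      field_simp
      ring
    simp only [hbase]
    rw [integral_const_mul, integral_const_mul, integral_sq_add_cpow s hA, hA',
      Complex.ofReal_mul, Complex.mul_cpow_ofReal_nonneg (by positivity) hD.le, ofReal_sq_cpow ha]
    ring
  rw [setIntegral_congr_fun measurableSet_Ioc hinner, integral_const_mul,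
    ← intervalIntegral.integral_of_le (by norm_num), integral_gegenbauer hs hr, mul_assoc _ _
      (∫ t in (-1 : ℝ)..1, ((1 - t ^ 2 : ℝ) : ℂ) ^ (s - 1)),
    integral_mul_integral_eq (by linarith)]
  have h1 : (((2 * a * y)⁻¹ : ℝ) : ℂ) ^ (-s) = (2 : ℂ) ^ s * (a : ℂ) ^ s * (y : ℂ) ^ s := by
    rw [Complex.ofReal_inv, Complex.inv_cpow _ _ (by
      rw [Complex.arg_ofReal_of_nonneg hκ.le]; exact Real.pi_pos.ne), ← Complex.cpow_neg, neg_neg,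
      Complex.ofReal_mul, Complex.mul_cpow_ofReal_nonneg (by positivity) hy.le, Complex.ofReal_mul,
      Complex.mul_cpow_ofReal_nonneg zero_le_two ha.le]
    norm_num
  have h2 : (2 : ℂ) ^ (-s) * (2 : ℂ) ^ s = 1 := by
    rw [← Complex.cpow_add _ _ two_ne_zero]; simp
  have h3 : (a : ℂ) ^ s * (a : ℂ) ^ (2 * (1 / 2 - s)) = (a : ℂ) ^ (1 - s) := by
    rw [← Complex.cpow_add _ _ (by exact_mod_cast ha.ne')]
    congr 1
    ring
  rw [h1]
  linear_combination (2 * Real.pi / (2 * s - 1) * (y : ℂ) ^ s) *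
    ((a : ℂ) ^ s * (a : ℂ) ^ (2 * (1 / 2 - s)) * h2 + h3)

/-! ### Invariance and horocycles -/

theorem one_add_two_mul_pointPairU (z w : ℍ) :
    1 + 2 * pointPairU z w = Real.cosh (dist z w) := by
  rw [UpperHalfPlane.cosh_dist, pointPairU, dist_eq_norm]
  ring

theorem re_unitTranslation_zpow_smul (n : ℤ) (z : ℍ) :
    (unitTranslation ^ n • z : ℍ).re = z.re + n := by
  have h (w : ℍ) : (unitTranslation • w : ℍ).re = w.re + 1 := by
    have := congrArg Complex.re (coe_unitTranslation_smul w)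
    simpa using this
  induction n with
  | zero => simp
  | succ n ih =>
    rw [zpow_add_one, ← (Commute.zpow_self unitTranslation _).eq.symm, mul_smul, h, ih]
    push_cast
    ring
  | pred n ih =>
    have h1 := h (unitTranslation ^ (-(n : ℤ) - 1) • z)
    rw [← mul_smul, ← zpow_one_add, add_sub_cancel, ih] at h1
    push_cast at h1 ⊢
    linarith

theorem hypSpeed_horocyclePath (σ : PSL(2, ℝ)) {a : ℝ} (ha : 0 < a) (x : ℝ) :
    hypSpeed (horocyclePath σ ha) x = a⁻¹ := by
  obtain ⟨g, rfl⟩ := QuotientGroup.mk_surjective σ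
  have hcoe (τ : ℝ) : (horocyclePath (g : PSL(2, ℝ)) ha τ : ℂ) =
      (g 0 0 * (τ + a * Complex.I) + g 0 1) / (g 1 0 * (τ + a * Complex.I) + g 1 1) := by
    rw [horocyclePath, psl_mk_smul, UpperHalfPlane.coe_specialLinearGroup_apply]
    simp [Complex.mk_eq_add_mul_I]
  have hdet : (g 0 0 : ℂ) * g 1 1 - g 0 1 * g 1 0 = 1 := by
    have := g.det_coe
    rw [Matrix.det_fin_two] at this
    exact_mod_cast this
  set d : ℂ := g 1 0 * (x + a * Complex.I) + g 1 1 with hd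
  have hd0 : d ≠ 0 := by
    have := UpperHalfPlane.denom_ne_zero (g : GL (Fin 2) ℝ) (⟨⟨x, a⟩, ha⟩ : ℍ)
    simpa [UpperHalfPlane.denom, hd, Complex.mk_eq_add_mul_I] using this
  have hderiv : HasDerivAt (fun τ : ℝ => (horocyclePath (g : PSL(2, ℝ)) ha τ : ℂ))
      ((d ^ 2)⁻¹) x := by
    simp only [hcoe]
    have h1 : HasDerivAt (fun τ : ℝ => (τ : ℂ) + a * Complex.I) 1 x :=
      (Complex.ofRealCLM.hasDerivAt (x := x)).add_const _
    refine (((h1.const_mul (g 0 0 : ℂ)).add_const (g 0 1 : ℂ)).div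
      ((h1.const_mul (g 1 0 : ℂ)).add_const (g 1 1 : ℂ)) hd0).congr_deriv ?_
    rw [← hd, inv_eq_one_div]
    congr 1
    rw [hd]
    linear_combination hdet
  have him : (horocyclePath (g : PSL(2, ℝ)) ha x).im = a / Complex.normSq d := by
    have := UpperHalfPlane.im_smul_eq_div_normSq (g : GL (Fin 2) ℝ) (⟨⟨x, a⟩, ha⟩ : ℍ)
    rw [horocyclePath, psl_mk_smul]
    refine Eq.trans this ?_
    simp [UpperHalfPlane.denom, hd, Complex.mk_eq_add_mul_I]
  rw [hypSpeed, hderiv.deriv, him, norm_inv, norm_pow, Complex.sq_norm]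
  have : Complex.normSq d ≠ 0 := by simpa using hd0
  field_simp

/-! ### Unfolding along the cusp -/

/-- Representatives of `Γ_p \ Γ` moving `z` to the strip `0 ≤ Re < 1` in the coordinate of the
cusp, and the resulting parametrization of `Γ`. -/
theorem exists_cusp_representatives {Γ : Subgroup PSL(2, ℝ)} {p : OnePoint ℝ} {σ : PSL(2, ℝ)}
    (hσ : IsScalingMatrix Γ p σ) (z : ℍ) :
    ∃ (r : CuspCosets Γ p → Γ) (e : CuspCosets Γ p × ℤ ≃ Γ),
      (∀ q, Quotient.mk _ (r q) = q) ∧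
      (∀ q, (σ⁻¹ • (r q : PSL(2, ℝ)) • z : ℍ).re ∈ Set.Ico (0 : ℝ) 1) ∧
      ∀ q n, σ⁻¹ • ((e (q, n) : Γ) : PSL(2, ℝ))⁻¹ • z =
        unitTranslation ^ (-n) • σ⁻¹ • (r q : PSL(2, ℝ)) • z := by
  obtain ⟨γ, hγ, hγσ⟩ := hσ
  have hconj : (γ : PSL(2, ℝ)) = σ * unitTranslation * σ⁻¹ := by rw [← hγσ]; group
  have hpow (n : ℤ) (η : Γ) : σ⁻¹ • ((γ ^ n * η : Γ) : PSL(2, ℝ)) • z =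
      unitTranslation ^ n • σ⁻¹ • (η : PSL(2, ℝ)) • z := by
    rw [Subgroup.coe_mul, Subgroup.coe_zpow, hconj, conj_zpow]
    simp [← mul_smul, mul_assoc]
  have hmk (n : ℤ) (η : Γ) : (Quotient.mk _ (γ ^ n * η) : CuspCosets Γ p) = Quotient.mk _ η := by
    refine Quotient.sound ?_
    change QuotientGroup.rightRel _ _ _
    rw [QuotientGroup.rightRel_apply, hγ, mul_inv_rev, mul_inv_cancel_left]
    exact inv_mem (Subgroup.zpow_mem_zpowers γ n)
  have hrep (q : CuspCosets Γ p) : ∃ η : Γ, Quotient.mk _ η = q ∧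
      (σ⁻¹ • (η : PSL(2, ℝ)) • z : ℍ).re ∈ Set.Ico (0 : ℝ) 1 := by
    refine ⟨γ ^ (-⌊(σ⁻¹ • (q.out : PSL(2, ℝ)) • z : ℍ).re⌋) * q.out, ?_, ?_⟩
    · rw [hmk, Quotient.out_eq]
    · rw [hpow, re_unitTranslation_zpow_smul, Int.cast_neg, ← sub_eq_add_neg, Int.self_sub_floor]
      exact ⟨Int.fract_nonneg _, Int.fract_lt_one _⟩
  choose r hr hre using hrep
  -- The inverse is there because the Green series moves `w` while the Eisenstein series moves `z`;
  -- the sign of `n` makes the shift appear as `x + n`.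
  have hbij : Function.Bijective fun x : CuspCosets Γ p × ℤ => (γ ^ (-x.2) * r x.1)⁻¹ := by
    constructor
    · rintro ⟨q, n⟩ ⟨q', n'⟩ h
      have h : γ ^ (-n) * r q = γ ^ (-n') * r q' := inv_injective h
      have hq : q = q' := by
        rw [← hr q, ← hr q', ← hmk (-n), ← hmk (-n') (r q'), h]
      subst hq
      have h1 := congrArg UpperHalfPlane.re (hpow (-n) (r q))
      rw [h, hpow, re_unitTranslation_zpow_smul, re_unitTranslation_zpow_smul] at h1
      have h2 : ((-n' : ℤ) : ℝ) = ((-n : ℤ) : ℝ) := by linarith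
      have h3 : n = n' := by
        have := Int.cast_injective h2
        omega
      rw [h3]
    · intro η
      obtain ⟨n, hn⟩ : η⁻¹ * (r (Quotient.mk _ η⁻¹))⁻¹ ∈ Subgroup.zpowers γ :=
        hγ.le (QuotientGroup.rightRel_apply.1 (Quotient.exact (hr _)))
      refine ⟨(Quotient.mk _ η⁻¹, -n), ?_⟩
      simp only [neg_neg]
      change γ ^ n = _ at hn
      rw [hn]
      group
  refine ⟨r, Equiv.ofBijective _ hbij, hr, hre, fun q n => ?_⟩
  rw [← hpow]
  simp

/-- The elements `(r q₀)⁻¹ * r q` are distinct for distinct `q` and move `z` by the distance between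
the two points, so a count at `z` bounds the count around every `q₀`. -/
theorem summable_im_rpow_cusp {Γ : Subgroup PSL(2, ℝ)} [DiscreteTopology Γ] {Q : Type*} (r : Q → Γ)
    (hr : Function.Injective r) {σ : PSL(2, ℝ)} {z : ℍ} {a t : ℝ} (ht : 1 < t)
    (hre : ∀ q, (σ⁻¹ • (r q : PSL(2, ℝ)) • z : ℍ).re ∈ Set.Ico (0 : ℝ) 1)
    (haz : ∀ η ∈ Γ, (σ⁻¹ • η • z : ℍ).im < a) :
    Summable fun q => (σ⁻¹ • (r q : PSL(2, ℝ)) • z : ℍ).im ^ t := by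
  refine summable_im_rpow (fun q => σ⁻¹ • (r q : PSL(2, ℝ)) • z) ht hre
    (fun q => haz _ (r q).2) fun R => ⟨{g : Γ | dist ((g : PSL(2, ℝ)) • z) z ≤ R}.ncard, fun q₀ => ?_⟩
  have hmaps : Set.MapsTo (fun q => (r q₀)⁻¹ * r q)
      {q | dist (σ⁻¹ • (r q : PSL(2, ℝ)) • z) (σ⁻¹ • (r q₀ : PSL(2, ℝ)) • z) ≤ R}
      {g : Γ | dist ((g : PSL(2, ℝ)) • z) z ≤ R} := by
    intro q hq
    rw [Set.mem_ofPred_eq, psl_dist_smul] at hq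
    rw [Set.mem_ofPred_eq, ← psl_dist_smul (r q₀ : PSL(2, ℝ)), ← mul_smul]
    simpa using hq
  have hinj : Function.Injective fun q => (r q₀)⁻¹ * r q :=
    (mul_right_injective _).comp hr
  exact ⟨Set.Finite.of_injOn hmaps hinj.injOn (finite_dist_smul_le Γ z R),
    Set.ncard_le_ncard_of_injOn _ hmaps hinj.injOn (finite_dist_smul_le Γ z R)⟩

/-- Only finitely many terms reach `a / 2`, so the supremum is at most `a / 2` or is attained. -/
theorem exists_bound_lt_of_summable_rpow {Q : Type*} {y : Q → ℝ} {a t : ℝ} (ht : 1 < t) (ha : 0 < a)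
    (hya : ∀ q, y q < a) (h : Summable fun q => y q ^ t) :
    ∃ b < a, ∀ q, y q ≤ b := by
  have hfin : {q | a / 2 ≤ y q}.Finite := by
    have h1 := h.tendsto_cofinite_zero.eventually_lt_const
      (Real.rpow_pos_of_pos (half_pos ha) t)
    refine (Filter.eventually_cofinite.1 h1).subset fun q hq => ?_
    exact not_lt.2 (Real.rpow_le_rpow (by positivity) hq (by linarith))
  rcases {q | a / 2 ≤ y q}.eq_empty_or_nonempty with he | hne
  · refine ⟨a / 2, by linarith, fun q => ?_⟩
    by_contra! hq
    have : q ∈ {q | a / 2 ≤ y q} := hq.le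
    simp [he] at this
  · obtain ⟨q₀, hq₀, hmax⟩ := Set.exists_max_image _ y hfin hne
    refine ⟨y q₀, hya q₀, fun q => ?_⟩
    rcases le_total (a / 2) (y q) with hq | hq
    · exact hmax q hq
    · exact hq.trans hq₀

theorem norm_legendreQ_horocycle_le {s : ℂ} (hs : 1 < s.re) {a b : ℝ} (hb : b < a) :
    ∃ C : ℝ, ∀ x ∈ Set.Icc (0 : ℝ) 1, ∀ x₀ ∈ Set.Ico (0 : ℝ) 1, ∀ y : ℝ, 0 < y → y ≤ b → ∀ n : ℤ,
      ‖legendreQ (s - 1) (1 + ((x + n - x₀) ^ 2 + (a - y) ^ 2) / (2 * a * y))‖ ≤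
        y ^ s.re * (C * (1 + (n : ℝ) ^ 2)⁻¹) := by
  obtain ⟨C, hC0, hC⟩ := exists_sq_add_rpow_le (pow_pos (sub_pos.2 hb) 2) hs
  refine ⟨2 * (2 * a) ^ s.re * C * 3, fun x hx x₀ hx₀ y hy hyb n => ?_⟩
  have ha : 0 < a := hy.trans_le (hyb.trans hb.le)
  have hay : (0 : ℝ) < (a - y) ^ 2 := pow_pos (by linarith) 2
  have h1 : (a - b) ^ 2 ≤ (a - y) ^ 2 := pow_le_pow_left₀ (by linarith) (by linarith) 2
  -- With `d = x - x₀` and `|d| ≤ 1`, `n² ≤ 2(n + d)² + 2`, whence the factor 3.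
  have h2 : (1 + (x + n - x₀) ^ 2)⁻¹ ≤ 3 * (1 + (n : ℝ) ^ 2)⁻¹ := by
    rw [← div_eq_mul_inv, inv_eq_one_div, div_le_div_iff₀ (by positivity) (by positivity)]
    have h3 : (x - x₀) ^ 2 ≤ 1 := by
      rw [sq_le_one_iff_abs_le_one, abs_le]
      constructor <;> linarith [hx.1, hx.2, hx₀.1, hx₀.2]
    nlinarith [sq_nonneg (2 * (x - x₀) + n)]
  calc _ ≤ 2 * (((x + n - x₀) ^ 2 + (a - y) ^ 2) / (2 * a * y)) ^ (-s.re) :=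
        norm_legendreQ_le hs (by positivity)
    _ = 2 * (2 * a) ^ s.re * y ^ s.re * ((x + n - x₀) ^ 2 + (a - y) ^ 2) ^ (-s.re) := by
        rw [Real.div_rpow (by positivity) (by positivity), Real.rpow_neg (x := 2 * a * y)
          (by positivity), div_inv_eq_mul, Real.mul_rpow (by positivity) hy.le]
        ring
    _ ≤ 2 * (2 * a) ^ s.re * y ^ s.re * ((x + n - x₀) ^ 2 + (a - b) ^ 2) ^ (-s.re) := by
        refine mul_le_mul_of_nonneg_left (Real.rpow_le_rpow_of_nonpos ?_ (by linarith)
          (by linarith)) (by positivity)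
        nlinarith [sq_nonneg (x + n - x₀), pow_pos (sub_pos.2 hb) 2]
    _ ≤ 2 * (2 * a) ^ s.re * y ^ s.re * (C * (3 * (1 + (n : ℝ) ^ 2)⁻¹)) := by
        refine mul_le_mul_of_nonneg_left ((hC _).trans ?_) (by positivity)
        gcongr
    _ = _ := by ring

theorem continuous_legendreQ_horocycle {s : ℂ} (hs : 1 < s.re) {a y : ℝ} (hy : 0 < y)
    (hya : y < a) (x₀ : ℝ) :
    Continuous fun x : ℝ => legendreQ (s - 1) (1 + ((x - x₀) ^ 2 + (a - y) ^ 2) / (2 * a * y)) := by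
  have ha := hy.trans hya
  refine (continuousOn_legendreQ hs).comp_continuous (by fun_prop) fun x => ?_
  have h1 : (0 : ℝ) < (a - y) ^ 2 := pow_pos (by linarith) 2
  have h2 : 0 < ((x - x₀) ^ 2 + (a - y) ^ 2) / (2 * a * y) := by positivity
  exact Set.mem_Ioi.2 (by linarith)

theorem greenTerm_horocyclePath (Γ : Subgroup PSL(2, ℝ)) (s : ℂ) (σ : PSL(2, ℝ)) (z z' : ℍ) {a : ℝ}
    (ha : 0 < a) (x : ℝ) (n : ℤ) (η : Γ)
    (h : σ⁻¹ • (η : PSL(2, ℝ))⁻¹ • z = unitTranslation ^ (-n) • z') :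
    greenTerm Γ s z (horocyclePath σ ha x) η =
      legendreQ (s - 1) (1 + ((x + n - z'.re) ^ 2 + (a - z'.im) ^ 2) / (2 * a * z'.im)) := by
  have h1 : dist z ((η : PSL(2, ℝ)) • horocyclePath σ ha x) =
      dist (unitTranslation ^ (-n) • z') (⟨⟨x, a⟩, ha⟩ : ℍ) := by
    rw [← h, horocyclePath, ← psl_dist_smul (σ⁻¹ * (η : PSL(2, ℝ))⁻¹), mul_smul, mul_smul,
      inv_smul_smul, inv_smul_smul]
  have h0 := z'.im_pos
  rw [greenTerm, one_add_two_mul_pointPairU, h1, UpperHalfPlane.cosh_dist, dist_eq_norm,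
    Complex.sq_norm, Complex.normSq_apply]
  simp only [Complex.sub_re, Complex.sub_im, UpperHalfPlane.coe_re, UpperHalfPlane.coe_im,
    re_unitTranslation_zpow_smul, im_unitTranslation_zpow_smul]
  congr 2
  change _ / (2 * z'.im * a) = _
  push_cast
  field_simp
  ring

theorem mainTheorem12 (Γ : Subgroup PSL(2, ℝ)) (hΓ : IsFuchsianFirstKind Γ)
    (p : OnePoint ℝ) (σ : PSL(2, ℝ)) (hσ : IsScalingMatrix Γ p σ)
    (z : ℍ) (s : ℂ) (hs : 1 < s.re) (a : ℝ) (ha : 0 < a)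
    (haz : ∀ η ∈ Γ, (σ⁻¹ • η • z : ℍ).im < a) :
    Summable (parEisensteinTerm Γ p σ z s) ∧
    (∀ w ∈ σ • horocycle a, (∀ η ∈ Γ, η • w ≠ z) ∧ Summable (greenTerm Γ s z w)) ∧
    IntervalIntegrable (fun x => hypGreen Γ s z (horocyclePath σ ha x)) volume 0 1 ∧
    parEisenstein Γ p σ z s =
      (2 * s - 1) * (a : ℂ) ^ s * hypArcIntegral (hypGreen Γ s z) (horocyclePath σ ha) 0 1 ∧
    parEisenstein Γ p σ z s =
      (2 * s - 1) * (a : ℂ) ^ (s - 1) *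
        ∫ x in (0 : ℝ)..1, hypGreen Γ s z (horocyclePath σ ha x) := by
  have := hΓ.discrete
  obtain ⟨r, e, hr, hre, he⟩ := exists_cusp_representatives hσ z
  have hrinj : Function.Injective r := fun q q' h => by rw [← hr q, ← hr q', h]
  set ζ : CuspCosets Γ p → ℍ := fun q => σ⁻¹ • (r q : PSL(2, ℝ)) • z with hζ
  have hpos (q) : 0 < (ζ q).im := (ζ q).im_pos
  have hlt (q) : (ζ q).im < a := haz _ (r q).2
  have hsum : Summable fun q => (ζ q).im ^ s.re := summable_im_rpow_cusp r hrinj hs hre haz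
  have hterm (q) : parEisensteinTerm Γ p σ z s q = ((ζ q).im : ℂ) ^ s := by
    conv_lhs => rw [← hr q]
    exact parEisensteinTerm_mk hσ z s (r q)
  obtain ⟨b, hba, hb⟩ := exists_bound_lt_of_summable_rpow hs ha hlt hsum
  obtain ⟨C, hC⟩ := norm_legendreQ_horocycle_le hs hba
  set ψ : CuspCosets Γ p → ℝ → ℂ := fun q x =>
    legendreQ (s - 1) (1 + ((x - (ζ q).re) ^ 2 + (a - (ζ q).im) ^ 2) / (2 * a * (ζ q).im)) with hψ
  have hψc (q) : Continuous (ψ q) := continuous_legendreQ_horocycle hs (hpos q) (hlt q) _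
  have hgreen (x : ℝ) (i : CuspCosets Γ p × ℤ) :
      greenTerm Γ s z (horocyclePath σ ha x) (e i) = ψ i.1 (x + i.2) :=
    greenTerm_horocyclePath Γ s σ z (ζ i.1) ha x i.2 (e i) (he i.1 i.2)
  set u : CuspCosets Γ p × ℤ → ℝ := fun i => (ζ i.1).im ^ s.re * (C * (1 + (i.2 : ℝ) ^ 2)⁻¹)
  have hu : Summable u := by
    have h1 : Summable fun n : ℤ => (1 + (n : ℝ) ^ 2)⁻¹ := by
      refine Summable.of_nonneg_of_le (fun n => by positivity) (fun n => ?_)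
        ((Real.summable_one_div_int_pow (p := 2)).2 one_lt_two |>.add
          (summable_of_ne_finset_zero (f := fun n : ℤ => if n = 0 then (1 : ℝ) else 0) (s := {0})
            (by intro n hn; simpa using hn)))
      by_cases hn : n = 0
      · simp [hn]
      · have : (0 : ℝ) < (n : ℝ) ^ 2 := by positivity
        simp only [hn, if_false, add_zero, one_div]
        exact inv_anti₀ this (by linarith)
    exact summable_mul_of_summable_norm hsum.norm (h1.mul_left C).norm
  have hbound (i) (x) (hx : x ∈ Set.Icc (0 : ℝ) 1) : ‖ψ i.1 (x + i.2)‖ ≤ u i :=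
    hC x hx _ (hre i.1) _ (hpos i.1) (hb i.1) i.2
  have hGreen (x : ℝ) : hypGreen Γ s z (horocyclePath σ ha x) =
      1 / (2 * (Real.pi : ℂ)) * ∑' i : CuspCosets Γ p × ℤ, ψ i.1 (x + i.2) := by
    rw [hypGreen, ← e.tsum_eq]
    simp only [hgreen]
  -- A summable family without zero terms has a countable index set, as dominated convergence
  -- requires.
  have hQ : Countable (CuspCosets Γ p) := by
    have h1 := hsum.countable_support
    rwa [Set.eq_univ_of_forall (s := Function.support fun q => (ζ q).im ^ s.re)
      (fun q => (Real.rpow_pos_of_pos (hpos q) _).ne'), Set.countable_univ_iff] at h1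
  have hexch := intervalIntegral.hasSum_integral_of_dominated_convergence (a := 0) (b := 1)
    (μ := volume) (F := fun (i : CuspCosets Γ p × ℤ) (x : ℝ) => ψ i.1 (x + i.2))
    (f := fun x => ∑' i : CuspCosets Γ p × ℤ, ψ i.1 (x + i.2)) (fun i _ => u i)
    (fun i => ((hψc i.1).comp (by fun_prop)).aestronglyMeasurable)
    (fun i => Filter.Eventually.of_forall fun x hx => by
      rw [Set.uIoc_of_le zero_le_one] at hx
      exact hbound i x ⟨hx.1.le, hx.2⟩)
    (Filter.Eventually.of_forall fun _ _ => hu) intervalIntegrable_const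
    (Filter.Eventually.of_forall fun x hx => by
      rw [Set.uIoc_of_le zero_le_one] at hx
      exact (Summable.of_norm_bounded hu fun i => hbound i x ⟨hx.1.le, hx.2⟩).hasSum)
  -- The unfolding: for fixed `q`, the integrals of the translates over `[0, 1]` sum to the integral
  -- over `ℝ`.
  have hfib := (hexch.prod_fiberwise fun q =>
    (integrable_legendreQ hs (hpos q) (hlt q) (ζ q).re).hasSum_intervalIntegral_comp_add_int).tsum_eq
  simp only [integral_legendreQ hs (hpos _) (hlt _)] at hfib
  rw [tsum_mul_left] at hfib
  have hs1 : 2 * s - 1 ≠ 0 := by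
    intro h
    have := congrArg Complex.re h
    simp at this
    linarith
  have hac : (a : ℂ) ≠ 0 := by exact_mod_cast ha.ne'
  have hmain : parEisenstein Γ p σ z s = (2 * s - 1) * (a : ℂ) ^ (s - 1) *
      ∫ x in (0 : ℝ)..1, hypGreen Γ s z (horocyclePath σ ha x) := by
    simp only [hGreen]
    rw [intervalIntegral.integral_const_mul, ← hfib, parEisenstein]
    simp only [hterm]
    have h1 : (a : ℂ) ^ (s - 1) * (a : ℂ) ^ (1 - s) = 1 := by
      rw [← Complex.cpow_add _ _ hac]
      simp
    have hpi : (Real.pi : ℂ) ≠ 0 := by exact_mod_cast Real.pi_ne_zero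
    field_simp
    linear_combination -(∑' q, ((ζ q).im : ℂ) ^ s) * h1
  refine ⟨?_, ?_, ?_, ?_, hmain⟩
  · refine Summable.of_norm_bounded hsum fun q => ?_
    rw [hterm, Complex.norm_cpow_eq_rpow_re_of_pos (hpos q)]
  · intro w hw
    constructor
    -- In the cusp coordinate `w` has height exactly `a`, while the whole orbit of `z` lies strictly
    -- below.
    · rintro η hη rfl
      obtain ⟨v, ⟨-, hv⟩, rfl⟩ := hw
      have := haz η⁻¹ (inv_mem hη)
      rw [inv_smul_smul] at this
      change (σ⁻¹ • σ • v : ℍ).im < a at this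
      rw [inv_smul_smul, hv] at this
      exact lt_irrefl _ this
    · rw [← horocyclePath_image σ ha] at hw
      obtain ⟨x, hx, rfl⟩ := hw
      rw [← e.summable_iff]
      refine Summable.of_norm_bounded hu fun i => ?_
      rw [Function.comp_apply, hgreen]
      exact hbound i x hx
  · refine ContinuousOn.intervalIntegrable ?_
    simp only [hGreen]
    rw [Set.uIcc_of_le zero_le_one]
    exact continuousOn_const.mul (continuousOn_tsum
      (fun i => ((hψc i.1).comp (by fun_prop)).continuousOn) hu hbound)
  · rw [hmain, hypArcIntegral]
    simp only [hypSpeed_horocyclePath]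
    rw [intervalIntegral.integral_mul_const, Complex.cpow_sub _ _ hac, Complex.cpow_one]
    push_cast
    ring
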